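/- Let $(\Lambda,d)$ be a metric space with a Borel probability measure $\mu$, and let $T:\Lambda\to\Lambda$ be an ergodic measure-preserving transformation. Let $X\subset\Lambda$ be a Borel set with $\mu(X)>0$, put $\mu_X=\mu|_X/\mu(X)$, and let $\varphi(x)=\inf\{n\ge1:T^nx\in X\}$ and $f=T^{\varphi}:X\to X$ be the first return time and first return map. Let $\alpha\in(1,2)$, let $G$ be a (nondegenerate) $\alpha$-stable law, and assume that $$n^{-1/\alpha}\Big(\sum_{j=0}^{n-1}\varphi\circ f^j-n\int_X\varphi\,d\mu_X\Big)\to_d G\quad\text{on }(X,\mu_X).$$ Let $v:\Lambda\to\mathbb R$ be Hölder continuous and integrable with $\int_\Lambda v\,d\mu=0$, set $v_\ell=\sum_{j=0}^{\ell-1}v\circ T^j$, and define $W_n(t)=n^{-1/\alpha}v_{[nt]}$ for $t\ge0$, as well as $$M_1=\max_{1\le\ell'\le\ell\le\varphi}(v_{\ell'}-v_\ell)\ \wedge\ \max_{1\le\ell'\le\ell\le\varphi}(v_\ell-v_{\ell'})\quad\text{on }X.$$ Let $W$ be a Lévy process with paths in the càdlàg space $D[0,\infty)$ such that $W(1)$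 has law $G$. Give $D[0,\infty)$ the Skorohod topology $\mathcal M_1$. If, for some constant $I\neq0$, $W_n$ (defined on $(\Lambda,\mu)$) converges weakly to $IW$ in $(D[0,\infty),\mathcal M_1)$ as $n\to\infty$, then $$n^{-1/\alpha}\max_{0\le j\le n}M_1\circ f^j\to0\quad\text{in probability on }(X,\mu_X).$$ (In particular this holds for every $T$ with a Chernov-Markarian-Zhang structure, where $f$ is in addition modelled by a Young tower with exponential tails.) -/

import Mathlib

open MeasureTheory ProbabilityTheory Filter Topology Set
open scoped NNReal ENNReal

noncomputable section

namespace LevyWIP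

/-! ### The space `D[0,∞)` with the `M₁` topology -/

/-- Right-continuous with left limits. -/
def IsCadlag (g : ℝ≥0 → ℝ) : Prop :=
  ∀ t, ContinuousWithinAt g (Ici t) t ∧ ∃ l, Tendsto g (𝓝[<] t) (𝓝 l)

/-- The càdlàg space `D[0,∞)`. -/
def SkorokhodD : Type := {g : ℝ≥0 → ℝ // IsCadlag g}

namespace SkorokhodD

instance : CoeFun SkorokhodD (fun _ => ℝ≥0 → ℝ) := ⟨Subtype.val⟩

lemma isCadlag_const_mul (c : ℝ) {g : ℝ≥0 → ℝ} (hg : IsCadlag g) :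
    IsCadlag (fun t => c * g t) := fun t =>
  ⟨continuousWithinAt_const.mul (hg t).1, let ⟨l, hl⟩ := (hg t).2; ⟨c * l, hl.const_mul c⟩⟩

/-- Pointwise scalar multiplication. -/
instance : SMul ℝ SkorokhodD := ⟨fun c g => ⟨fun t => c * g.1 t, isCadlag_const_mul c g.2⟩⟩

/-- The completed graph of `g` on `[0,T]`: all points `(t, s)` with `0 ≤ t ≤ T` and `s` on the
segment between `g(t-)` and `g(t)`. Here `g(0-) = g(0)`. -/
def completedGraph (T : ℝ≥0) (g : SkorokhodD) : Set (ℝ≥0 × ℝ) :=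
  {p | p.1 ≤ T ∧ p.2 ∈ segment ℝ (Function.leftLim g p.1) (g p.1)}

/-- `(τ, γ)` is a parametrization of the completed graph of `g` on `[0,T]`: a continuous map from
`[0,1]` onto the completed graph that traverses it in its natural order (time does not decrease,
and along a jump the curve moves from `g(t-)` towards `g(t)`). -/
structure IsParametrization (T : ℝ≥0) (g : SkorokhodD) (τ : unitInterval → ℝ≥0) (γ : unitInterval → ℝ) : Prop where
  continuous_time : Continuous τ
  continuous_space : Continuous γ
  range_eq : range (fun s => (τ s, γ s)) = completedGraph T g
  ordered : ∀ s' s, s' < s → τ s' < τ s ∨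
    (τ s' = τ s ∧ |γ s - g (τ s)| ≤ |γ s' - g (τ s')|)

/-- The `M₁` distance between the restrictions of `g₁`, `g₂` to `[0,T]`: the infimum over all
parametrizations of `‖γ₁ - γ₂‖ ∨ ‖τ₁ - τ₂‖` (uniform norms). -/
def distM1On (T : ℝ≥0) (g₁ g₂ : SkorokhodD) : ℝ≥0∞ :=
  ⨅ (τ₁ : unitInterval → ℝ≥0) (γ₁ : unitInterval → ℝ) (τ₂ : unitInterval → ℝ≥0) (γ₂ : unitInterval → ℝ)
    (_ : IsParametrization T g₁ τ₁ γ₁) (_ : IsParametrization T g₂ τ₂ γ₂),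
    max (⨆ s, edist (γ₁ s) (γ₂ s)) (⨆ s, edist (τ₁ s) (τ₂ s))

/-- The `M₁` distance on `D[0,∞)`: `∫₀^∞ e^{-T} (d_{M₁,[0,T]}(g₁,g₂) ∧ 1) dT`. -/
def distM1 (g₁ g₂ : SkorokhodD) : ℝ≥0∞ :=
  ∫⁻ T in Ioi (0 : ℝ), ENNReal.ofReal (Real.exp (-T)) * min (distM1On T.toNNReal g₁ g₂) 1

/-- The `M₁` topology, i.e. the topology of the distance `distM1`: a set is open when it contains
a ball around each of its points. -/
instance : TopologicalSpace SkorokhodD where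
  IsOpen U := ∀ g ∈ U, ∃ ε > 0, {h | distM1 g h < ε} ⊆ U
  isOpen_univ := fun _ _ => ⟨1, one_pos, subset_univ _⟩
  isOpen_inter := by
    rintro U V hU hV g ⟨hgU, hgV⟩
    obtain ⟨a, ha, hUa⟩ := hU g hgU
    obtain ⟨b, hb, hVb⟩ := hV g hgV
    refine ⟨min a b, lt_min ha hb, fun h hh => ?_⟩
    have hh' : distM1 g h < min a b := hh
    have ha' : distM1 g h < a := hh'.trans_le (min_le_left a b)
    have hb' : distM1 g h < b := hh'.trans_le (min_le_right a b)
    exact ⟨hUa ha', hVb hb'⟩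
  isOpen_sUnion := by
    rintro S hS g ⟨U, hU, hg⟩
    obtain ⟨a, ha, hUa⟩ := hS U hU g hg
    exact ⟨a, ha, hUa.trans (subset_sUnion_of_mem hU)⟩

/-- The Borel σ-algebra of the `M₁` topology. -/
instance : MeasurableSpace SkorokhodD := borel _

instance : BorelSpace SkorokhodD := ⟨rfl⟩

end SkorokhodD

/-! ### Stable laws and Lévy processes -/

/-- `G` is an `α`-stable law: a nondegenerate probability law such that, for independent
`Z₁, Z₂` with law `G` and `a, b > 0`, the variable `a Z₁ + b Z₂` has the law of
`(a^α + b^α)^{1/α} Z₁ + d` for some `d ∈ ℝ`. -/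
structure IsStableLaw (α : ℝ) (G : Measure ℝ) [IsProbabilityMeasure G] : Prop where
  nondegenerate : ∀ c : ℝ, G ≠ Measure.dirac c
  stable : ∀ a b : ℝ, 0 < a → 0 < b → ∃ d : ℝ,
    (G.prod G).map (fun z : ℝ × ℝ => a * z.1 + b * z.2) =
      G.map (fun z : ℝ => (a ^ α + b ^ α) ^ (1 / α) * z + d)

/-- `W` is a Lévy process with paths in `D[0,∞)`. -/
structure IsLevyProcess {Ω : Type*} [MeasurableSpace Ω] (P : Measure Ω) (W : Ω → SkorokhodD) :
    Prop where
  measurable_eval : ∀ t, Measurable (fun ω => W ω t)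
  start_zero : ∀ᵐ ω ∂P, W ω 0 = 0
  indepIncrements : HasIndepIncrements (fun (t : ℝ≥0) ω => W ω t) P
  stationaryIncrements : ∀ s t : ℝ≥0,
    P.map (fun ω => W ω (s + t) - W ω s) = P.map (fun ω => W ω t)

/-! ### Return maps and excursions -/

section Dynamics

variable {Λ : Type*}

/-- The first return time `φ(x) = inf {n ≥ 1 : Tⁿ x ∈ X}` (with value `0` if there is no return). -/
def firstReturnTime (T : Λ → Λ) (X : Set Λ) (x : Λ) : ℕ :=
  sInf {n : ℕ | 1 ≤ n ∧ T^[n] x ∈ X}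

/-- The first return map `f(x) = T^{φ(x)} x`. -/
def firstReturnMap (T : Λ → Λ) (X : Set Λ) (x : Λ) : Λ :=
  T^[firstReturnTime T X x] x

/-- `M₁ = max_{1≤ℓ'≤ℓ≤φ} (v_{ℓ'} - v_ℓ) ∧ max_{1≤ℓ'≤ℓ≤φ} (v_ℓ - v_{ℓ'})`, where
`v_ℓ = ∑_{j<ℓ} v ∘ T^j`. -/
def excursionM1 (T : Λ → Λ) (X : Set Λ) (v : Λ → ℝ) (x : Λ) : ℝ :=
  min
    (sSup {r : ℝ | ∃ l' l : ℕ, 1 ≤ l' ∧ l' ≤ l ∧ l ≤ firstReturnTime T X x ∧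
      r = birkhoffSum T v l' x - birkhoffSum T v l x})
    (sSup {r : ℝ | ∃ l' l : ℕ, 1 ≤ l' ∧ l' ≤ l ∧ l ≤ firstReturnTime T X x ∧
      r = birkhoffSum T v l x - birkhoffSum T v l' x})

lemma isCadlag_comp_floor (u : ℕ → ℝ) (n : ℕ) :
    IsCadlag (fun t => u ⌊(n : ℝ≥0) * t⌋₊) := by
  intro t
  have hc : Continuous (fun s : ℝ≥0 => (n : ℝ≥0) * s) := by fun_prop
  constructor
  · have h1 : ∀ᶠ s in 𝓝[≥] t, (n : ℝ≥0) * s < ⌊(n : ℝ≥0) * t⌋₊ + 1 :=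
      (hc.tendsto t).mono_left nhdsWithin_le_nhds |>.eventually_lt_const (Nat.lt_floor_add_one _)
    have h2 : (fun s => u ⌊(n : ℝ≥0) * s⌋₊) =ᶠ[𝓝[≥] t] fun _ => u ⌊(n : ℝ≥0) * t⌋₊ := by
      filter_upwards [h1, self_mem_nhdsWithin] with s hs hts
      have h3 : ⌊(n : ℝ≥0) * s⌋₊ = ⌊(n : ℝ≥0) * t⌋₊ := by
        refine (Nat.floor_eq_iff zero_le).2 ⟨?_, hs⟩
        exact (Nat.floor_le zero_le).trans (mul_le_mul_right hts _)
      rw [h3]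
    exact tendsto_const_nhds.congr' h2.symm
  · refine ⟨u (⌈(n : ℝ≥0) * t⌉₊ - 1), ?_⟩
    have h2 : (fun s => u ⌊(n : ℝ≥0) * s⌋₊) =ᶠ[𝓝[<] t]
        fun _ => u (⌈(n : ℝ≥0) * t⌉₊ - 1) := by
      rcases Nat.eq_zero_or_pos ⌈(n : ℝ≥0) * t⌉₊ with h0 | h0
      · filter_upwards [self_mem_nhdsWithin] with s hs
        have h4 : (n : ℝ≥0) * s ≤ (n : ℝ≥0) * t := mul_le_mul_right (le_of_lt hs) _
        have h5 : (n : ℝ≥0) * t ≤ 0 := by simpa [h0] using Nat.le_ceil ((n : ℝ≥0) * t)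
        have h6 : (n : ℝ≥0) * s = 0 := le_antisymm (h4.trans h5) zero_le
        rw [h6, h0]; simp
      · obtain ⟨k, hk⟩ := Nat.exists_eq_succ_of_ne_zero h0.ne'
        have hk1 : (k : ℝ≥0) < (n : ℝ≥0) * t := Nat.lt_ceil.1 (by omega)
        have hk2 : (n : ℝ≥0) * t ≤ (k : ℝ≥0) + 1 := by
          simpa [hk] using Nat.le_ceil ((n : ℝ≥0) * t)
        have hn : (0 : ℝ≥0) < n := by
          rcases Nat.eq_zero_or_pos n with h | h
          · simp [h] at hk1
          · exact_mod_cast h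
        have h1 : ∀ᶠ s in 𝓝[<] t, (k : ℝ≥0) < (n : ℝ≥0) * s :=
          (hc.tendsto t).mono_left nhdsWithin_le_nhds |>.eventually_const_lt hk1
        filter_upwards [h1, self_mem_nhdsWithin] with s hs hst
        have h3 : ⌊(n : ℝ≥0) * s⌋₊ = k :=
          (Nat.floor_eq_iff zero_le).2
            ⟨hs.le, ((mul_lt_mul_iff_right₀ hn).2 hst).trans_le hk2⟩
        rw [h3, hk]; simp
    exact tendsto_const_nhds.congr' h2.symm

/-- `W_n(t) = n^{-1/α} ∑_{j=0}^{[nt]-1} v ∘ T^j`, as a random element of `D[0,∞)`. -/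
def partialSumProcess (α : ℝ) (T : Λ → Λ) (v : Λ → ℝ) (n : ℕ) (x : Λ) : SkorokhodD :=
  ⟨fun t => (n : ℝ) ^ (-(1 / α)) * birkhoffSum T v ⌊(n : ℝ≥0) * t⌋₊ x,
    SkorokhodD.isCadlag_const_mul _ (isCadlag_comp_floor (fun k => birkhoffSum T v k x) n)⟩

end Dynamics

end LevyWIP

end

/-!
Why the maximum of `M₁` is negligible: convergence in law for the `M₁` topology rules out that, at
times very close to each other, the process first moves substantially in one direction and then
back. An excursion with large `M₁` does precisely this, since its path makes both a large increase
and a large decrease, hence has a large peak or a large valley (`exists_peak_or_valley`). It remains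
to see that excursions are short on the time scale of the process. With `S m` the sum of the first
`m` return times, the limit theorem for return times gives `S m / m → a` in probability because
`α > 1` (`tendsto_measure_le_abs_sub`). As `S` is nondecreasing, evaluating it on a finite grid
shows that, with probability tending to `1`, none of the first `n + 1` increments of `S` exceeds
`δ n` (`tendsto_measure_exists_lt_increment`), and that the first `n + 1` excursions end by time
`K n` for a fixed `K` (`tendsto_measure_lt_of_law_of_large_numbers`).

The absence of peaks is made quantitative by a functional on `D[0,∞)`, `maxPeak σ L K`. It is the
supremum, over `t₁ ≤ t₂ ≤ t₃`, of `min (σ g(t₂) - σ g(t₁)) (σ g(t₂) - σ g(t₃))`, truncated at `1`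
and penalized by `L (t₃ - t₁)` and by `(t₃ - K)⁺`. Two facts about it carry the proof.
* It is uniformly continuous for the `M₁` distance (`SkorokhodD.continuous_maxPeak`): uniformly
  close parametrizations transport a peak of one path to a peak on the completed graph of the other,
  and a peak on a completed graph is nearly attained by the path itself, jumps being traversed
  monotonically (`exists_peak_near`). Hence its expectation passes to the limit.
* For each càdlàg path it tends to `0` as `L → ∞` (`tendsto_maxPeak_atTop`), so by dominated
  convergence its expectation for the limit process is small when `L` is large.

A large value of `M₁` in an excursion of length at most `δ n` bounds `maxPeak 1 L K` or
`maxPeak (-1) L K` of the process from below (`exists_le_maxPeak_of_lt_excursionM1`), and Markov's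
inequality finishes the proof. Probabilities pass from `μ` to the conditional measure on `X` at the
cost of the factor `(μ X)⁻¹`.
-/

namespace LevyWIP

/-! ### Peaks of a càdlàg path and the `M₁` distance -/

lemma IsCadlag.tendsto_leftLim {g : ℝ≥0 → ℝ} (hg : IsCadlag g) (u : ℝ≥0) :
    Tendsto g (𝓝[<] u) (𝓝 (Function.leftLim g u)) :=
  tendsto_leftLim_of_tendsto (hg u).2

/-- Given a point `(u, c)` of a completed graph, the path takes a value that is at most slightly
larger than `c` at `u` or at a time slightly to the left of `u`, which may be kept to the right of
any prescribed `b < u`. -/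
lemma exists_le_near_of_mem_segment {g : ℝ≥0 → ℝ} {u b : ℝ≥0} {l c η : ℝ}
    (hl : Tendsto g (𝓝[<] u) (𝓝 l)) (hc : c ∈ segment ℝ l (g u)) (hη : 0 < η)
    (hb : b ≤ u) (h : b < u ∨ g u ≤ c) :
    ∃ t, b ≤ t ∧ t ≤ u ∧ (u : ℝ) ≤ t + η ∧ g t ≤ c + η := by
  by_cases hgu : g u ≤ c
  · exact ⟨u, hb, le_rfl, by linarith, by linarith⟩
  have hbu : b < u := h.resolve_right hgu
  have hlc : l ≤ c := by
    rw [segment_eq_uIcc, mem_uIcc] at hc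
    rcases hc with hc | hc
    · exact hc.1
    · exact absurd hc.1 hgu
  have : (𝓝[<] u).NeBot := nhdsLT_neBot_of_exists_lt ⟨b, hbu⟩
  have h1 : ∀ᶠ t in 𝓝[<] u, g t < c + η := hl.eventually_lt_const (by linarith)
  have h2 : ∀ᶠ t in 𝓝[<] u, b < t :=
    (tendsto_id.mono_left nhdsWithin_le_nhds : Tendsto id (𝓝[<] u) (𝓝 u)).eventually_const_lt hbu
  have h3 : ∀ᶠ t : ℝ≥0 in 𝓝[<] u, (u : ℝ) - η < t := by
    have : Tendsto (fun t : ℝ≥0 => (t : ℝ)) (𝓝[<] u) (𝓝 (u : ℝ)) :=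
      (NNReal.continuous_coe.tendsto u).mono_left nhdsWithin_le_nhds
    exact this.eventually_const_lt (by linarith)
  obtain ⟨t, h1, h2, h3, h4⟩ := (h1.and (h2.and (h3.and self_mem_nhdsWithin))).exists
  exact ⟨t, h2.le, le_of_lt h4, by linarith, h1.le⟩

lemma neg_mem_segment_neg {l c r : ℝ} (h : c ∈ segment ℝ l r) : -c ∈ segment ℝ (-l) (-r) := by
  rw [segment_eq_uIcc, mem_uIcc] at *
  rcases h with h | h
  · right; constructor <;> linarith
  · left; constructor <;> linarith

lemma exists_ge_near_of_mem_segment {g : ℝ≥0 → ℝ} {u b : ℝ≥0} {l c η : ℝ}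
    (hl : Tendsto g (𝓝[<] u) (𝓝 l)) (hc : c ∈ segment ℝ l (g u)) (hη : 0 < η)
    (hb : b ≤ u) (h : b < u ∨ c ≤ g u) :
    ∃ t, b ≤ t ∧ t ≤ u ∧ (u : ℝ) ≤ t + η ∧ c - η ≤ g t := by
  obtain ⟨t, h1, h2, h3, h4⟩ := exists_le_near_of_mem_segment (g := fun t => -g t) (l := -l)
    (c := -c) hl.neg (neg_mem_segment_neg hc) hη hb (h.imp_right neg_le_neg)
  exact ⟨t, h1, h2, h3, by linarith⟩

/-- If three points of a completed graph, in its natural order, form a peak, then the path itself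
forms almost the same peak at three nearby times. The order along a jump is what makes this true:
a jump is traversed monotonically, so no peak occurs inside it. Here `l u` stands for the left limit
of `g` at `u`, with `l 0 = g 0`. -/
lemma exists_peak_near {g l : ℝ≥0 → ℝ} (hl : ∀ u, Tendsto g (𝓝[<] u) (𝓝 (l u))) (hl0 : l 0 = g 0)
    {u₁ u₂ u₃ : ℝ≥0} {c₁ c₂ c₃ η : ℝ}
    (hc₁ : c₁ ∈ segment ℝ (l u₁) (g u₁)) (hc₂ : c₂ ∈ segment ℝ (l u₂) (g u₂))
    (hc₃ : c₃ ∈ segment ℝ (l u₃) (g u₃))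
    (h12 : u₁ < u₂ ∨ u₁ = u₂ ∧ |c₂ - g u₂| ≤ |c₁ - g u₁|)
    (h23 : u₂ < u₃ ∨ u₂ = u₃ ∧ |c₃ - g u₃| ≤ |c₂ - g u₂|)
    (h1 : c₁ < c₂) (h3 : c₃ < c₂) (hη : 0 < η) :
    ∃ t₁ t₂ t₃ : ℝ≥0, t₁ ≤ t₂ ∧ t₂ ≤ t₃ ∧ t₃ ≤ u₃ ∧ (u₁ : ℝ) ≤ t₁ + η ∧
      g t₁ ≤ c₁ + η ∧ c₂ - η ≤ g t₂ ∧ g t₃ ≤ c₃ + η := by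
  obtain ⟨t₁, -, ht₁, ht₁', hg₁⟩ :=
      exists_le_near_of_mem_segment (b := 0) (hl u₁) hc₁ hη zero_le (by
    rcases eq_zero_or_pos u₁ with h | h
    · right
      subst h
      rw [hl0, segment_same] at hc₁
      exact (Set.mem_singleton_iff.1 hc₁).ge
    · exact Or.inl h)
  by_cases hg : c₂ ≤ g u₂
  · have hu : u₂ ≤ u₃ := h23.elim le_of_lt (fun h => h.1.le)
    obtain ⟨t₃, ht₃, ht₃', -, hg₃⟩ := exists_le_near_of_mem_segment (hl u₃) hc₃ hη hu (by
      rcases h23 with h | ⟨h, h'⟩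
      · exact Or.inl h
      · right
        rw [h] at hg h'
        by_contra! hlt
        rw [abs_of_neg (by linarith), abs_of_nonpos (by linarith)] at h'
        linarith)
    exact ⟨t₁, u₂, t₃, ht₁.trans (h12.elim le_of_lt (fun h => h.1.le)), ht₃, ht₃', ht₁', hg₁,
      by linarith, hg₃⟩
  · push Not at hg
    rw [segment_eq_uIcc, mem_uIcc] at hc₁ hc₃
    have hc₂' := hc₂
    rw [segment_eq_uIcc, mem_uIcc] at hc₂'
    -- Here `c₂` lies above `g u₂`, hence the jump at `u₂` is downward.
    have hd : c₂ ≤ l u₂ := by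
      rcases hc₂' with h | h
      · linarith [h.2]
      · exact h.2
    have hu : u₁ < u₂ := by
      rcases h12 with h | ⟨h, h'⟩
      · exact h
      · subst h
        exfalso
        have : g u₁ ≤ c₁ := by
          rcases hc₁ with h | h
          · linarith [h.1, h.2]
          · exact h.1
        rw [abs_of_pos (by linarith), abs_of_nonneg (by linarith)] at h'
        linarith
    obtain ⟨t₂, ht₂, ht₂', -, hg₂⟩ :=
      exists_ge_near_of_mem_segment (hl u₂) hc₂ hη hu.le (Or.inl hu)
    obtain ⟨t₃, ht₃, ht₃', -, hg₃⟩ := exists_le_near_of_mem_segment (b := t₂) (c := c₃) (hl u₃)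
      (by rwa [segment_eq_uIcc, mem_uIcc]) hη (ht₂'.trans (h23.elim le_of_lt (fun h => h.1.le))) (by
      rcases h23 with h | ⟨h, -⟩
      · exact Or.inl (ht₂'.trans_lt h)
      · right
        subst h
        rcases hc₃ with h | h
        · linarith [h.1, h.2]
        · exact h.1)
    exact ⟨t₁, t₂, t₃, ht₁.trans ht₂, ht₃, ht₃', ht₁', hg₁, hg₂, hg₃⟩

/-- The height (truncated at `1`) of the peak that `σ g` has at the times `t₁ ≤ t₂ ≤ t₃`, penalized
by `L` times its duration and by the time by which it exceeds the horizon `K`. With `σ = -1` this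
measures valleys of `g`. -/
noncomputable def peakHeight (σ L K : ℝ) (g : ℝ≥0 → ℝ) (t₁ t₂ t₃ : ℝ≥0) : ℝ :=
  min (min (σ * g t₂ - σ * g t₁) (σ * g t₂ - σ * g t₃)) 1 - L * (t₃ - t₁) - max (t₃ - K) 0

/-- The largest penalized peak height of `σ g`. The penalties replace a modulus over short intervals
in a bounded time horizon, and make the functional continuous for the `M₁` distance. -/
noncomputable def maxPeak (σ L K : ℝ) (g : ℝ≥0 → ℝ) : ℝ :=
  sSup {r | ∃ t₁ t₂ t₃ : ℝ≥0, t₁ ≤ t₂ ∧ t₂ ≤ t₃ ∧ r = peakHeight σ L K g t₁ t₂ t₃}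

section

variable {σ L K : ℝ} {g : ℝ≥0 → ℝ}

lemma peakHeight_le_one (hL : 0 ≤ L) {t₁ t₂ t₃ : ℝ≥0} (h12 : t₁ ≤ t₂) (h23 : t₂ ≤ t₃) :
    peakHeight σ L K g t₁ t₂ t₃ ≤ 1 := by
  have h : (t₁ : ℝ) ≤ t₃ := h12.trans h23
  have := mul_nonneg hL (sub_nonneg.2 h)
  have := le_max_right ((t₃ : ℝ) - K) 0
  have := min_le_right (min (σ * g t₂ - σ * g t₁) (σ * g t₂ - σ * g t₃)) 1
  unfold peakHeight
  linarith

lemma peakHeight_le_maxPeak (hL : 0 ≤ L) {t₁ t₂ t₃ : ℝ≥0} (h12 : t₁ ≤ t₂) (h23 : t₂ ≤ t₃) :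
    peakHeight σ L K g t₁ t₂ t₃ ≤ maxPeak σ L K g :=
  le_csSup ⟨1, by rintro _ ⟨a, b, c, hab, hbc, rfl⟩; exact peakHeight_le_one hL hab hbc⟩
    ⟨t₁, t₂, t₃, h12, h23, rfl⟩

lemma maxPeak_le {c : ℝ}
    (h : ∀ t₁ t₂ t₃ : ℝ≥0, t₁ ≤ t₂ → t₂ ≤ t₃ → peakHeight σ L K g t₁ t₂ t₃ ≤ c) :
    maxPeak σ L K g ≤ c :=
  csSup_le ⟨_, 0, 0, 0, le_rfl, le_rfl, rfl⟩
    (by rintro _ ⟨a, b, c, hab, hbc, rfl⟩; exact h _ _ _ hab hbc)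

lemma maxPeak_nonneg (hL : 0 ≤ L) (hK : 0 ≤ K) : 0 ≤ maxPeak σ L K g := by
  refine le_trans ?_ (peakHeight_le_maxPeak hL (le_refl 0) (le_refl 0))
  simp [peakHeight, hK]

lemma maxPeak_le_one (hL : 0 ≤ L) : maxPeak σ L K g ≤ 1 :=
  maxPeak_le fun _ _ _ h12 h23 => peakHeight_le_one hL h12 h23

/-- As the penalty on the duration grows, the largest penalized peak of a càdlàg path vanishes:
three times that are close together lie within two intervals on each of which the path hardly
oscillates. -/
lemma tendsto_maxPeak_atTop (hσ : |σ| ≤ 1) (hK : 0 ≤ K) (hg : IsCadlag g) :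
    Tendsto (fun m : ℕ => maxPeak σ m K g) atTop (𝓝 0) := by
  refine tendsto_order.2 ⟨fun a ha => .of_forall fun m =>
    ha.trans_le (maxPeak_nonneg (Nat.cast_nonneg m) hK), fun a ha => ?_⟩
  have hloc : ∀ t : ℝ≥0, ∃ U : Set ℝ≥0, IsOpen U ∧ t ∈ U ∧
      (∀ s ∈ U, ∀ s' ∈ U, t ≤ s → t ≤ s' → |g s - g s'| ≤ a / 2) ∧
      (∀ s ∈ U, ∀ s' ∈ U, s < t → s' < t → |g s - g s'| ≤ a / 2) := by
    intro t
    have h1 : ∀ᶠ s in 𝓝[≥] t, |g s - g t| < a / 4 := by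
      simpa [Real.dist_eq] using Metric.tendsto_nhds.1 (hg t).1 (a / 4) (by linarith)
    have h2 : ∀ᶠ s in 𝓝[<] t, |g s - Function.leftLim g t| < a / 4 := by
      simpa [Real.dist_eq] using Metric.tendsto_nhds.1 (hg.tendsto_leftLim t) (a / 4) (by linarith)
    rw [eventually_nhdsWithin_iff] at h1 h2
    obtain ⟨U, hU, hUo, htU⟩ := eventually_nhds_iff.1 (h1.and h2)
    refine ⟨U, hUo, htU, fun s hs s' hs' h h' => ?_, fun s hs s' hs' h h' => ?_⟩
    · have := abs_sub_le (g s) (g t) (g s')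
      have := (hU s hs).1 h
      have := (hU s' hs').1 h'
      rw [abs_sub_comm] at this
      linarith
    · have := abs_sub_le (g s) (Function.leftLim g t) (g s')
      have := (hU s hs).2 h
      have := (hU s' hs').2 h'
      rw [abs_sub_comm] at this
      linarith
  choose U hUo htU hUr hUl using hloc
  obtain ⟨δ, hδ, hδU⟩ := lebesgue_number_lemma_of_metric
    (isCompact_Icc (a := (0 : ℝ≥0)) (b := (K + 1).toNNReal)) hUo
    (fun t _ => mem_iUnion.2 ⟨t, htU t⟩)
  have hm : ∀ᶠ m : ℕ in atTop, 1 ≤ (m : ℝ) * δ :=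
    (tendsto_natCast_atTop_atTop.atTop_mul_const hδ).eventually_ge_atTop 1
  filter_upwards [hm] with m hm
  refine lt_of_le_of_lt (b := a / 2) (maxPeak_le fun t₁ t₂ t₃ h12 h23 => ?_) (by linarith)
  have h12' : (t₁ : ℝ) ≤ t₂ := h12
  have h23' : (t₂ : ℝ) ≤ t₃ := h23
  have hmin1 := min_le_right (min (σ * g t₂ - σ * g t₁) (σ * g t₂ - σ * g t₃)) 1
  have hmin2 := min_le_left (min (σ * g t₂ - σ * g t₁) (σ * g t₂ - σ * g t₃)) 1
  have hmin3 := min_le_left (σ * g t₂ - σ * g t₁) (σ * g t₂ - σ * g t₃)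
  have hmin4 := min_le_right (σ * g t₂ - σ * g t₁) (σ * g t₂ - σ * g t₃)
  have hpos : 0 ≤ (m : ℝ) * (t₃ - t₁) := mul_nonneg (Nat.cast_nonneg m) (by linarith)
  have hmax0 := le_max_right ((t₃ : ℝ) - K) 0
  have hmax1 := le_max_left ((t₃ : ℝ) - K) 0
  unfold peakHeight
  -- Beyond the time `K + 1` the penalty exceeds the truncation level.
  by_cases hKt : K + 1 ≤ t₃
  · linarith
  by_cases hd : δ ≤ t₃ - t₁
  · have : (m : ℝ) * δ ≤ m * (t₃ - t₁) := mul_le_mul_of_nonneg_left hd (Nat.cast_nonneg m)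
    linarith
  push Not at hKt hd
  obtain ⟨i, hi⟩ := hδU t₁ ⟨zero_le, (Real.le_toNNReal_iff_coe_le (by linarith)).2 (by linarith)⟩
  have hU1 : t₁ ∈ U i := hi (Metric.mem_ball_self hδ)
  have hU2 : t₂ ∈ U i := hi (by
    rw [Metric.mem_ball, NNReal.dist_eq, abs_of_nonneg (by linarith)]; linarith)
  have hU3 : t₃ ∈ U i := hi (by
    rw [Metric.mem_ball, NNReal.dist_eq, abs_of_nonneg (by linarith)]; linarith)
  have key : ∀ s s' : ℝ≥0, |g s - g s'| ≤ a / 2 → σ * g s - σ * g s' ≤ a / 2 := fun s s' h => by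
    rw [← mul_sub]
    calc σ * (g s - g s') ≤ |σ| * |g s - g s'| := by rw [← abs_mul]; exact le_abs_self _
      _ ≤ 1 * (a / 2) := mul_le_mul hσ h (abs_nonneg _) zero_le_one
      _ = a / 2 := one_mul _
  rcases le_or_gt i t₂ with h | h
  · have := key _ _ (hUr i t₂ hU2 t₃ hU3 h (h.trans h23))
    linarith
  · have := key _ _ (hUl i t₂ hU2 t₁ hU1 h (h12.trans_lt h))
    linarith

end

namespace SkorokhodD

lemma IsParametrization.mem_segment {T : ℝ≥0} {g : SkorokhodD} {τ : unitInterval → ℝ≥0}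
    {γ : unitInterval → ℝ} (h : IsParametrization T g τ γ) (s : unitInterval) :
    γ s ∈ segment ℝ (Function.leftLim g (τ s)) (g (τ s)) := by
  have : (τ s, γ s) ∈ completedGraph T g := h.range_eq ▸ mem_range_self s
  exact this.2

lemma IsParametrization.exists_eq {T : ℝ≥0} {g : SkorokhodD} {τ : unitInterval → ℝ≥0}
    {γ : unitInterval → ℝ} (h : IsParametrization T g τ γ) {t : ℝ≥0} (ht : t ≤ T) :
    ∃ s, τ s = t ∧ γ s = g t := by
  have : (t, g t) ∈ range (fun s => (τ s, γ s)) := by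
    rw [h.range_eq]
    exact ⟨ht, right_mem_segment ℝ _ _⟩
  obtain ⟨s, hs⟩ := this
  exact ⟨s, congrArg Prod.fst hs, congrArg Prod.snd hs⟩

/-- The largest penalized peak changes little between two paths whose completed graphs have
parametrizations that are uniformly close. -/
lemma maxPeak_le_add {σ L K κ : ℝ} (hσ : |σ| ≤ 1) (hL : 0 ≤ L) (hK : 0 ≤ K) (hκ : 0 < κ)
    {T : ℝ≥0} (hT : K + 1 ≤ T) {g h : SkorokhodD} {τ₁ τ₂ : unitInterval → ℝ≥0}
    {γ₁ γ₂ : unitInterval → ℝ}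
    (hg : IsParametrization T g τ₁ γ₁) (hh : IsParametrization T h τ₂ γ₂)
    (hγ : ∀ s, |γ₁ s - γ₂ s| ≤ κ) (hτ : ∀ s, |(τ₁ s : ℝ) - τ₂ s| ≤ κ) :
    maxPeak σ L K h ≤ maxPeak σ L K g + (5 + 3 * L) * κ := by
  refine maxPeak_le fun t₁ t₂ t₃ h12 h23 => ?_
  have hF : 0 ≤ maxPeak σ L K g := maxPeak_nonneg hL hK
  have h12' : (t₁ : ℝ) ≤ t₂ := h12
  have h23' : (t₂ : ℝ) ≤ t₃ := h23
  have hLκ : 0 ≤ L * κ := mul_nonneg hL hκ.le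
  have hC : (5 + 3 * L) * κ = 5 * κ + 3 * (L * κ) := by ring
  rw [hC]
  have hmin1 := min_le_right (min (σ * h t₂ - σ * h t₁) (σ * h t₂ - σ * h t₃)) 1
  have hmin2 := min_le_left (min (σ * h t₂ - σ * h t₁) (σ * h t₂ - σ * h t₃)) 1
  have hmin3 := min_le_left (σ * h t₂ - σ * h t₁) (σ * h t₂ - σ * h t₃)
  have hmin4 := min_le_right (σ * h t₂ - σ * h t₁) (σ * h t₂ - σ * h t₃)
  have hpos : 0 ≤ L * ((t₃ : ℝ) - t₁) := mul_nonneg hL (by linarith)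
  have hmax0 := le_max_right ((t₃ : ℝ) - K) 0
  have hmax1 := le_max_left ((t₃ : ℝ) - K) 0
  have hrw : peakHeight σ L K h t₁ t₂ t₃ = min (min (σ * h t₂ - σ * h t₁) (σ * h t₂ - σ * h t₃)) 1
    - L * (t₃ - t₁) - max (t₃ - K) 0 := rfl
  set m := min (min (σ * h t₂ - σ * h t₁) (σ * h t₂ - σ * h t₃)) 1
  -- Beyond the time `K + 1` the penalty exceeds the truncation level.
  by_cases hKt : K + 1 ≤ t₃
  · rw [hrw]; linarith
  push Not at hKt
  have hT3 : t₃ ≤ T := by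
    have : (t₃ : ℝ) ≤ T := by linarith
    exact this
  obtain ⟨s₁, hs₁, hs₁'⟩ := hh.exists_eq (h12.trans (h23.trans hT3))
  obtain ⟨s₂, hs₂, hs₂'⟩ := hh.exists_eq (h23.trans hT3)
  obtain ⟨s₃, hs₃, hs₃'⟩ := hh.exists_eq hT3
  have hd : ∀ s, |σ * γ₁ s - σ * γ₂ s| ≤ κ := fun s => by
    rw [← mul_sub, abs_mul]
    calc |σ| * |γ₁ s - γ₂ s| ≤ 1 * κ := mul_le_mul hσ (hγ s) (abs_nonneg _) zero_le_one
      _ = κ := one_mul _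
  have hd1 := abs_le.1 (hd s₁)
  have hd2 := abs_le.1 (hd s₂)
  have hd3 := abs_le.1 (hd s₃)
  rw [hs₁'] at hd1
  rw [hs₂'] at hd2
  rw [hs₃'] at hd3
  -- If the corresponding points for `g` form no peak, then the peak of `h` has height at most `2κ`.
  by_cases hlt : σ * γ₁ s₁ < σ * γ₁ s₂ ∧ σ * γ₁ s₃ < σ * γ₁ s₂
  swap
  · rw [hrw]
    rcases not_and_or.1 hlt with hlt | hlt <;> push Not at hlt <;> linarith
  obtain ⟨hlt1, hlt3⟩ := hlt
  -- Consecutive times of a genuine peak are distinct, so the parametrization of `h` visits them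
  -- in order.
  have hord : ∀ {a b : unitInterval} {t t' : ℝ≥0}, τ₂ a = t → τ₂ b = t' → γ₂ a = h t →
      γ₂ b = h t' → t ≤ t' → σ * γ₁ a ≠ σ * γ₁ b → σ * h t ≠ σ * h t' → a < b := by
    intro a b t t' ha hb hγa hγb hab hne hne'
    rcases lt_trichotomy a b with hab' | hab' | hab'
    · exact hab'
    · exact absurd (by rw [hab']) hne
    · exfalso
      have : t ≠ t' := by rintro rfl; exact hne' rfl
      rcases hh.ordered b a hab' with h' | h'
      · rw [ha, hb] at h'
        exact absurd h' (not_lt.2 hab)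
      · rw [ha, hb] at h'
        exact this h'.1.symm
  by_cases hne : σ * h t₁ = σ * h t₂ ∨ σ * h t₂ = σ * h t₃
  · rw [hrw]
    rcases hne with hne | hne <;> linarith
  push Not at hne
  have hs12 : s₁ < s₂ := hord hs₁ hs₂ hs₁' hs₂' h12 hlt1.ne hne.1
  have hs23 : s₂ < s₃ := hord hs₂ hs₃ hs₂' hs₃' h23 hlt3.ne' hne.2
  have hsegσ : ∀ {c a b : ℝ}, c ∈ segment ℝ a b → σ * c ∈ segment ℝ (σ * a) (σ * b) := by
    rintro _ a b ⟨p, q, hp, hq, hpq, rfl⟩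
    exact ⟨p, q, hp, hq, hpq, by simp only [smul_eq_mul]; ring⟩
  have hordσ : ∀ {a b : unitInterval}, a < b → τ₁ a < τ₁ b ∨ τ₁ a = τ₁ b ∧
      |σ * γ₁ b - σ * g (τ₁ b)| ≤ |σ * γ₁ a - σ * g (τ₁ a)| := fun {a b} hab =>
    (hg.ordered a b hab).imp_right fun h' => ⟨h'.1, by
      rw [← mul_sub, ← mul_sub, abs_mul, abs_mul]
      exact mul_le_mul_of_nonneg_left h'.2 (abs_nonneg _)⟩
  obtain ⟨r₁, r₂, r₃, hr12, hr23, hr3, hr1, hc1, hc2, hc3⟩ := exists_peak_near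
    (g := fun t => σ * g t) (l := fun t => σ * Function.leftLim g t)
    (fun u => (IsCadlag.tendsto_leftLim g.2 u).const_mul σ)
    (congrArg (σ * ·) (leftLim_eq_of_isBot (f := g) isBot_bot))
    (hsegσ (hg.mem_segment s₁)) (hsegσ (hg.mem_segment s₂)) (hsegσ (hg.mem_segment s₃))
    (hordσ hs12) (hordσ hs23) hlt1 hlt3 hκ
  refine le_trans ?_
    (add_le_add_left (peakHeight_le_maxPeak (σ := σ) (K := K) (g := g) hL hr12 hr23) _)
  have hτ1 := abs_le.1 (hτ s₁)
  have hτ3 := abs_le.1 (hτ s₃)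
  rw [hs₁] at hτ1
  rw [hs₃] at hτ3
  have hr3' : (r₃ : ℝ) ≤ τ₁ s₃ := hr3
  have e1 : m - 4 * κ ≤ min (min (σ * g r₂ - σ * g r₁) (σ * g r₂ - σ * g r₃)) 1 :=
    le_min (le_min (by linarith) (by linarith)) (by linarith)
  have e2 : L * ((r₃ : ℝ) - r₁) ≤ L * (t₃ - t₁) + 3 * (L * κ) := by
    have : L * ((r₃ : ℝ) - r₁) ≤ L * (t₃ - t₁ + 3 * κ) :=
      mul_le_mul_of_nonneg_left (by linarith) hL
    linarith
  have e3 : max ((r₃ : ℝ) - K) 0 ≤ max ((t₃ : ℝ) - K) 0 + κ :=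
    max_le (by linarith) (by linarith)
  rw [hrw, peakHeight]
  linarith

/-- Paths at small `M₁` distance on `[0,∞)` have uniformly close parametrizations on some `[0,T]`
with `T > K`. -/
lemma exists_parametrizations_of_distM1_lt {K κ : ℝ} (hK : 0 ≤ K) (hκ : 0 < κ) (hκ1 : κ ≤ 1)
    {g h : SkorokhodD} (hd : distM1 g h < ENNReal.ofReal (Real.exp (-(K + 1)) * κ)) :
    ∃ (T : ℝ≥0) (τ₁ : unitInterval → ℝ≥0) (γ₁ : unitInterval → ℝ) (τ₂ : unitInterval → ℝ≥0)
      (γ₂ : unitInterval → ℝ), K ≤ T ∧ IsParametrization T g τ₁ γ₁ ∧ IsParametrization T h τ₂ γ₂ ∧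
      (∀ s, |γ₁ s - γ₂ s| ≤ κ) ∧ ∀ s, |(τ₁ s : ℝ) - τ₂ s| ≤ κ := by
  have hex : ∃ T ∈ Ioo K (K + 1), distM1On T.toNNReal g h < ENNReal.ofReal κ := by
    by_contra! hcon
    refine absurd hd (not_lt.2 ?_)
    calc ENNReal.ofReal (Real.exp (-(K + 1)) * κ)
        = ∫⁻ _ in Ioo K (K + 1), ENNReal.ofReal (Real.exp (-(K + 1)) * κ) := by simp
      _ ≤ ∫⁻ T in Ioo K (K + 1),
            ENNReal.ofReal (Real.exp (-T)) * min (distM1On T.toNNReal g h) 1 := by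
          refine setLIntegral_mono' measurableSet_Ioo fun T hT => ?_
          rw [ENNReal.ofReal_mul (Real.exp_pos _).le]
          refine mul_le_mul' (ENNReal.ofReal_le_ofReal (Real.exp_le_exp.2 (by linarith [hT.2])))
            (le_min (hcon T hT) ?_)
          simpa using ENNReal.ofReal_le_ofReal hκ1
      _ ≤ distM1 g h := lintegral_mono_set fun T hT => hK.trans_lt hT.1
  obtain ⟨T, hT, hlt⟩ := hex
  simp only [distM1On, iInf_lt_iff, max_lt_iff] at hlt
  obtain ⟨τ₁, γ₁, τ₂, γ₂, hp₁, hp₂, h1, h2⟩ := hlt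
  refine ⟨T.toNNReal, τ₁, γ₁, τ₂, γ₂, hT.1.le.trans (Real.le_coe_toNNReal T), hp₁, hp₂,
    fun s => ?_, fun s => ?_⟩
  · have := (le_iSup (fun s => edist (γ₁ s) (γ₂ s)) s).trans h1.le
    rwa [edist_dist, ENNReal.ofReal_le_ofReal_iff hκ.le, Real.dist_eq] at this
  · have := (le_iSup (fun s => edist (τ₁ s) (τ₂ s)) s).trans h2.le
    rwa [edist_dist, ENNReal.ofReal_le_ofReal_iff hκ.le, NNReal.dist_eq] at this

/-- The largest penalized peak is uniformly continuous for the `M₁` distance. -/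
lemma continuous_maxPeak {σ L K : ℝ} (hσ : |σ| ≤ 1) (hL : 0 ≤ L) (hK : 0 ≤ K) :
    Continuous (fun g : SkorokhodD => maxPeak σ L K g) := by
  refine continuous_def.2 fun V hV g hgV => ?_
  obtain ⟨ε, hε, hball⟩ := Metric.isOpen_iff.1 hV _ hgV
  set κ := min 1 (ε / (2 * (5 + 3 * L)))
  have hκ : 0 < κ := lt_min one_pos (by positivity)
  refine ⟨ENNReal.ofReal (Real.exp (-(K + 1 + 1)) * κ),
    ENNReal.ofReal_pos.2 (mul_pos (Real.exp_pos _) hκ), fun h hd => hball ?_⟩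
  obtain ⟨T, τ₁, γ₁, τ₂, γ₂, hT, hp₁, hp₂, hγ, hτ⟩ :=
    exists_parametrizations_of_distM1_lt (by linarith : 0 ≤ K + 1) hκ (min_le_left _ _) hd
  have h1 := maxPeak_le_add hσ hL hK hκ hT hp₁ hp₂ hγ hτ
  have h2 := maxPeak_le_add hσ hL hK hκ hT hp₂ hp₁ (fun s => by rw [abs_sub_comm]; exact hγ s)
    (fun s => by rw [abs_sub_comm]; exact hτ s)
  have h3 : (5 + 3 * L) * κ ≤ ε / 2 := by
    calc (5 + 3 * L) * κ ≤ (5 + 3 * L) * (ε / (2 * (5 + 3 * L))) :=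
          mul_le_mul_of_nonneg_left (min_le_right _ _) (by linarith)
      _ = ε / 2 := by
          have : 5 + 3 * L ≠ 0 := by positivity
          field_simp
  rw [Metric.mem_ball, Real.dist_eq, abs_lt]
  constructor <;> linarith

end SkorokhodD

/-! ### Excursions seen as peaks of the partial sum process -/

section

variable {Λ : Type*} {T : Λ → Λ} {X : Set Λ} {v : Λ → ℝ}

/-- Iterating the first return map `j` times is iterating `T` up to the `j`-th return time. -/
lemma firstReturnMap_iterate (j : ℕ) (x : Λ) :
    (firstReturnMap T X)^[j] x =
      T^[birkhoffSum (firstReturnMap T X) (firstReturnTime T X) j x] x := by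
  induction j with
  | zero => rfl
  | succ j ih =>
    rw [Function.iterate_succ_apply', birkhoffSum_succ, add_comm, Function.iterate_add_apply, ← ih]
    rfl

lemma excursionM1_nonneg (y : Λ) : 0 ≤ excursionM1 T X v y := by
  rcases Nat.eq_zero_or_pos (firstReturnTime T X y) with h | h
  · -- Both suprema are taken over the empty set, hence are `0` by convention.
    have hemp : ∀ r : ℕ → ℕ → ℝ, {s : ℝ | ∃ l' l : ℕ, 1 ≤ l' ∧ l' ≤ l ∧
        l ≤ firstReturnTime T X y ∧ s = r l' l} = ∅ := fun r => by
      ext s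
      simp only [mem_ofPred_eq, mem_empty_iff_false, iff_false]
      rintro ⟨l', l, h1, h2, h3, -⟩
      omega
    rw [excursionM1, hemp, hemp fun l' l => birkhoffSum T v l y - birkhoffSum T v l' y]
    simp
  · exact le_min (Real.sSup_nonneg' ⟨0, ⟨1, 1, le_rfl, le_rfl, h, (sub_self _).symm⟩, le_rfl⟩)
      (Real.sSup_nonneg' ⟨0, ⟨1, 1, le_rfl, le_rfl, h, (sub_self _).symm⟩, le_rfl⟩)

/-- A finite sequence that has both a large decrease and a large increase has a large peak
(`σ = 1`) or a large valley (`σ = -1`). -/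
lemma exists_peak_or_valley (w : ℕ → ℝ) {a b p p' q q' : ℕ} {η : ℝ} (hη : 0 ≤ η)
    (hp : a ≤ p) (hpp : p ≤ p') (hp' : p' ≤ b) (hq : a ≤ q) (hqq : q ≤ q') (hq' : q' ≤ b)
    (hdown : 2 * η < w p - w p') (hup : 2 * η < w q' - w q) :
    ∃ σ : ℝ, (σ = 1 ∨ σ = -1) ∧ ∃ i j k : ℕ, a ≤ i ∧ i ≤ j ∧ j ≤ k ∧ k ≤ b ∧
      η ≤ σ * w j - σ * w i ∧ η ≤ σ * w j - σ * w k := by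
  -- Compare with the endpoints: if the sequence rises overall, the decrease produces a peak or a
  -- valley, and otherwise the increase does.
  rcases le_total (w a) (w b) with h | h
  · by_cases hc : w b + η ≤ w p
    · exact ⟨1, .inl rfl, a, p, b, le_rfl, hp, hpp.trans hp', le_rfl, by linarith, by linarith⟩
    · exact ⟨-1, .inr rfl, p, p', b, hp, hpp, hp', le_rfl, by linarith, by linarith⟩
  · by_cases hc : w q ≤ w b - η
    · exact ⟨-1, .inr rfl, a, q, b, le_rfl, hq, hqq.trans hq', le_rfl, by linarith, by linarith⟩
    · exact ⟨1, .inl rfl, q, q', b, hq, hqq, hq', le_rfl, by linarith, by linarith⟩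

lemma exists_peak_or_valley_of_lt_excursionM1 {y : Λ} {η : ℝ} (hη : 0 ≤ η)
    (h : 2 * η < excursionM1 T X v y) :
    ∃ σ : ℝ, (σ = 1 ∨ σ = -1) ∧ ∃ i j k : ℕ, i ≤ j ∧ j ≤ k ∧ k ≤ firstReturnTime T X y ∧
      η ≤ σ * birkhoffSum T v j y - σ * birkhoffSum T v i y ∧
      η ≤ σ * birkhoffSum T v j y - σ * birkhoffSum T v k y := by
  have hex : ∀ s : Set ℝ, 2 * η < sSup s → ∃ r ∈ s, 2 * η < r := fun s hs => by
    refine exists_lt_of_lt_csSup (nonempty_iff_ne_empty.2 fun h0 => ?_) hs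
    rw [h0, Real.sSup_empty] at hs
    linarith
  rw [excursionM1, lt_min_iff] at h
  obtain ⟨_, ⟨p, p', hp, hpp, hp', rfl⟩, hdown⟩ := hex _ h.1
  obtain ⟨_, ⟨q, q', hq, hqq, hq', rfl⟩, hup⟩ := hex _ h.2
  obtain ⟨σ, hσ, i, j, k, -, hij, hjk, hk, h1, h2⟩ := exists_peak_or_valley
    (fun l => birkhoffSum T v l y) hη hp hpp hp' hq hqq hq' hdown hup
  exact ⟨σ, hσ, i, j, k, hij, hjk, hk, h1, h2⟩

lemma partialSumProcess_div (α : ℝ) {n : ℕ} (hn : n ≠ 0) (k : ℕ) (x : Λ) :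
    partialSumProcess α T v n x ((k : ℝ≥0) / n) =
      (n : ℝ) ^ (-(1 / α)) * birkhoffSum T v k x := by
  have : (n : ℝ≥0) * ((k : ℝ≥0) / n) = k := mul_div_cancel₀ _ (Nat.cast_ne_zero.2 hn)
  change _ * birkhoffSum T v ⌊(n : ℝ≥0) * ((k : ℝ≥0) / n)⌋₊ x = _
  rw [this, Nat.floor_natCast]

/-- If one of the first `n + 1` excursions makes `M₁` large, then the rescaled process has a peak
or a valley of comparable height, whose duration is at most that of the excursion. -/
lemma exists_le_maxPeak_of_lt_excursionM1 {α : ℝ} {n : ℕ} (hn : n ≠ 0) {x : Λ} {η δ K L : ℝ}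
    (hη : 0 ≤ η) (hL : 0 ≤ L) {j : ℕ} (hj : j ≤ n)
    (hM : 2 * η < (n : ℝ) ^ (-(1 / α)) * excursionM1 T X v ((firstReturnMap T X)^[j] x))
    (hδ : (firstReturnTime T X ((firstReturnMap T X)^[j] x) : ℝ) ≤ δ * n)
    (hK : ((birkhoffSum (firstReturnMap T X) (firstReturnTime T X) (n + 1) x : ℕ) : ℝ) ≤ K * n) :
    ∃ σ : ℝ, (σ = 1 ∨ σ = -1) ∧
      min η 1 - L * δ ≤ maxPeak σ L K (partialSumProcess α T v n x) := by
  set S := fun m => birkhoffSum (firstReturnMap T X) (firstReturnTime T X) m x with hS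
  set c := (n : ℝ) ^ (-(1 / α)) with hc
  have hn0 : (0 : ℝ) < n := by positivity
  have hc0 : 0 < c := Real.rpow_pos_of_pos hn0 _
  obtain ⟨σ, hσ, i, k, l, hik, hkl, hl, h1, h2⟩ := exists_peak_or_valley_of_lt_excursionM1
    (η := η / c) (div_nonneg hη hc0.le) (by
      rw [← mul_div_assoc, div_lt_iff₀ hc0, mul_comm (excursionM1 _ _ _ _)]
      exact hM)
  refine ⟨σ, hσ, ?_⟩
  have hadd : ∀ m, birkhoffSum T v m ((firstReturnMap T X)^[j] x) =
      birkhoffSum T v (S j + m) x - birkhoffSum T v (S j) x := fun m => by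
    rw [birkhoffSum_add, firstReturnMap_iterate]
    ring
  simp only [hadd] at h1 h2
  have hSj : S j + l ≤ S (n + 1) := by
    have h3 : S (j + 1) = S j + firstReturnTime T X ((firstReturnMap T X)^[j] x) :=
      birkhoffSum_succ ..
    have h4 : S (j + 1) ≤ S (n + 1) :=
      monotone_nat_of_le_succ (fun m => by rw [hS]; simp only [birkhoffSum_succ]; omega)
        (by omega : j + 1 ≤ n + 1)
    omega
  have hdiv : ∀ {a b : ℕ}, a ≤ b → (a : ℝ≥0) / n ≤ (b : ℝ≥0) / n := fun h =>
    div_le_div_of_nonneg_right (Nat.cast_le.2 h) zero_le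
  refine le_trans ?_ (peakHeight_le_maxPeak hL (hdiv (Nat.add_le_add_left hik (S j)))
    (hdiv (Nat.add_le_add_left hkl (S j))))
  rw [peakHeight, partialSumProcess_div α hn, partialSumProcess_div α hn,
    partialSumProcess_div α hn, ← hc]
  have hmul : ∀ {a b d : ℝ}, η / c ≤ σ * (a - d) - σ * (b - d) → η ≤ σ * (c * a) - σ * (c * b) :=
    fun {a b d} h => by
      rw [div_le_iff₀ hc0] at h
      calc η ≤ _ := h
        _ = _ := by ring
  have e1 := min_le_min_right 1 (le_min (hmul h1) (hmul h2))
  have e2 : L * ((((S j + l : ℕ) : ℝ≥0) / (n : ℝ≥0) : ℝ≥0) -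
      (((S j + i : ℕ) : ℝ≥0) / (n : ℝ≥0) : ℝ≥0) : ℝ) ≤ L * δ := by
    refine mul_le_mul_of_nonneg_left ?_ hL
    push_cast
    rw [← sub_div, div_le_iff₀ hn0]
    have : (l : ℝ) ≤ firstReturnTime T X ((firstReturnMap T X)^[j] x) := Nat.cast_le.2 hl
    have : (0 : ℝ) ≤ i := Nat.cast_nonneg i
    linarith
  have e3 : max (((((S j + l : ℕ) : ℝ≥0) / (n : ℝ≥0) : ℝ≥0) : ℝ) - K) 0 = 0 := by
    refine max_eq_right (sub_nonpos.2 ?_)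
    rw [NNReal.coe_div, NNReal.coe_natCast, NNReal.coe_natCast, div_le_iff₀ hn0]
    exact (Nat.cast_le.2 hSj).trans hK
  rw [e3]
  linarith

end

/-! ### Return times: a weak law of large numbers -/

section

variable {Ω : Type*} [MeasurableSpace Ω] {ν : Measure Ω}

/-- If the fluctuations of `S m` around `m a` are of order `m ^ (1 / α)` with `α > 1`, then
`S m / m` tends to `a` in probability. -/
lemma tendsto_measure_le_abs_sub [IsProbabilityMeasure ν] {α : ℝ} (hα : 1 < α) {S : ℕ → Ω → ℝ}
    {a : ℝ} {G : Measure ℝ} [IsProbabilityMeasure G]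
    (h : TendstoInDistribution (fun (n : ℕ) x => (n : ℝ) ^ (-(1 / α)) * (S n x - n * a)) atTop
      (id : ℝ → ℝ) (fun _ => ν) G) {κ : ℝ} (hκ : 0 < κ) :
    Tendsto (fun n : ℕ => ν {x | κ * n ≤ |S n x - n * a|}) atTop (𝓝 0) := by
  have hexp : 0 < 1 - 1 / α := by
    rw [sub_pos, div_lt_one (by linarith)]
    exact hα
  -- Slutsky's theorem applied to the factor that turns `n ^ (-1 / α)` into `n⁻¹`.
  have hY : TendstoInMeasure ν (fun (n : ℕ) (_ : Ω) => (n : ℝ) ^ (-(1 - 1 / α))) atTop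
      (fun _ => (0 : ℝ)) := by
    refine tendstoInMeasure_of_tendsto_ae (fun _ => aestronglyMeasurable_const)
      (.of_forall fun x => ?_)
    exact (tendsto_rpow_neg_atTop hexp).comp tendsto_natCast_atTop_atTop
  have hZ := h.continuous_comp_prodMk_of_tendstoInMeasure_const (g := fun p : ℝ × ℝ => p.1 * p.2)
    (by fun_prop) hY (fun _ => aemeasurable_const)
  have hF : IsClosed {z : ℝ | κ ≤ |z|} := isClosed_le continuous_const continuous_abs
  have hlim := ProbabilityMeasure.limsup_measure_closed_le_of_tendsto hZ.tendsto hF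
  have hzero : G.map (fun z : ℝ => (id z : ℝ) * 0) {z : ℝ | κ ≤ |z|} = 0 := by
    rw [Measure.map_apply (by fun_prop) hF.measurableSet]
    simp [not_le.2 hκ]
  have htend := tendsto_of_le_liminf_of_limsup_le (a := (0 : ℝ≥0∞)) zero_le (hlim.trans hzero.le)
  refine (tendsto_congr' ?_).1 htend
  filter_upwards [eventually_ne_atTop 0] with n hn
  have hn0 : (0 : ℝ) < n := by positivity
  simp only [ProbabilityMeasure.coe_mk]
  rw [Measure.map_apply_of_aemeasurable (hZ.forall_aemeasurable n) hF.measurableSet]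
  congr 1
  ext x
  have hpow : (n : ℝ) ^ (-(1 / α)) * (S n x - n * a) * (n : ℝ) ^ (-(1 - 1 / α)) =
      (S n x - n * a) / n := by
    rw [mul_right_comm, ← Real.rpow_add hn0]
    have : -(1 / α) + -(1 - 1 / α) = -1 := by ring
    rw [this, Real.rpow_neg_one, div_eq_inv_mul]
  simp only [mem_preimage, mem_ofPred_eq]
  rw [hpow, abs_div, abs_of_pos hn0, le_div_iff₀ hn0]

/-- The increments of a nondecreasing sequence that obeys a weak law of large numbers are uniformly
`o(n)`: each of them is contained in the increment over a block of a grid with boundedly many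
points. -/
lemma tendsto_measure_exists_lt_increment {S : ℕ → Ω → ℕ} (hS0 : ∀ x, S 0 x = 0)
    (hS : ∀ x, Monotone fun m => S m x) {a : ℝ} (ha : 0 ≤ a)
    (h : ∀ κ : ℝ, 0 < κ →
      Tendsto (fun n : ℕ => ν {x | κ * n ≤ |(S n x : ℝ) - n * a|}) atTop (𝓝 0))
    {δ : ℝ} (hδ : 0 < δ) :
    Tendsto (fun n : ℕ => ν {x | ∃ j ≤ n, δ * n < (S (j + 1) x : ℝ) - S j x}) atTop (𝓝 0) := by
  obtain ⟨N, hN⟩ := exists_nat_ge (2 * (a + 2) / δ)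
  have hN0 : (0 : ℝ) < N := lt_of_lt_of_le (by positivity) hN
  have hNpos : 0 < N := by exact_mod_cast hN0
  -- The block length; `N` blocks of this length cover `{0, …, n}`.
  set q : ℕ → ℕ := fun n => n / N + 1 with hq
  have hqtop : Tendsto q atTop atTop :=
    (tendsto_add_atTop_nat 1).comp (Nat.tendsto_div_const_atTop hNpos.ne')
  have hk : ∀ k : ℕ,
      Tendsto (fun n => ν {x | (q n : ℝ) ≤ |(S (k * q n) x : ℝ) - (k * q n : ℕ) * a|})
        atTop (𝓝 0) := by
    intro k
    rcases Nat.eq_zero_or_pos k with rfl | hk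
    · refine tendsto_const_nhds.congr fun n => ?_
      have : {x | (q n : ℝ) ≤ |(S (0 * q n) x : ℝ) - (0 * q n : ℕ) * a|} = ∅ := by
        ext x
        simpa [hS0, hq] using Nat.cast_add_one_pos (α := ℝ) (n / N)
      rw [this, measure_empty]
    · have hk' : (0 : ℝ) < k := by exact_mod_cast hk
      refine ((h (1 / k) (by positivity)).comp (hqtop.const_mul_atTop' hk)).congr fun n => ?_
      simp only [Function.comp_apply]
      congr 1
      ext x
      simp only [mem_ofPred_eq]
      rw [show 1 / (k : ℝ) * ((k * q n : ℕ) : ℝ) = q n by push_cast; field_simp]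
  have hsum : Tendsto (fun n => ∑ k ∈ Finset.range (N + 1),
      ν {x | (q n : ℝ) ≤ |(S (k * q n) x : ℝ) - (k * q n : ℕ) * a|}) atTop (𝓝 0) := by
    simpa using tendsto_finsetSum (Finset.range (N + 1)) fun k _ => hk k
  refine tendsto_of_tendsto_of_tendsto_of_le_of_le' tendsto_const_nhds hsum
    (.of_forall fun _ => zero_le) ?_
  filter_upwards [eventually_ge_atTop N] with n hn
  refine (measure_mono fun x hx => ?_).trans (measure_biUnion_finset_le _ _)
  obtain ⟨j, hj, hx⟩ := hx
  by_contra hcon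
  simp only [mem_iUnion, Finset.mem_range, mem_ofPred_eq, exists_prop, not_exists, not_and,
    not_le] at hcon
  have hq0 : 0 < q n := Nat.succ_pos _
  have hjN : j < q n * N := by
    have := Nat.lt_mul_div_succ n hNpos
    rw [mul_comm] at this
    exact hj.trans_lt this
  set k := j / q n
  have hkN : k < N := Nat.div_lt_of_lt_mul hjN
  have h1 := abs_lt.1 (hcon k (by omega))
  have h2 := abs_lt.1 (hcon (k + 1) (by omega))
  have h3 : (S (k * q n) x : ℝ) ≤ S j x := Nat.cast_le.2 (hS x (Nat.div_mul_le_self j (q n)))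
  have h4 : (S (j + 1) x : ℝ) ≤ S ((k + 1) * q n) x :=
    Nat.cast_le.2 (hS x (Nat.lt_mul_of_div_lt (Nat.lt_succ_self k) hq0))
  have h5 : (q n : ℝ) * N ≤ 2 * n := by
    have : q n * N ≤ 2 * n := by
      have := Nat.div_mul_le_self n N
      rw [hq]
      simp only [add_mul]
      omega
    exact_mod_cast this
  have h6 : 2 * (a + 2) ≤ N * δ := (div_le_iff₀ hδ).1 hN
  have h7 : (q n : ℝ) * (a + 2) ≤ δ * n := by
    have : (q n : ℝ) * (2 * (a + 2)) ≤ q n * (N * δ) :=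
      mul_le_mul_of_nonneg_left h6 (Nat.cast_nonneg _)
    have := mul_le_mul_of_nonneg_right h5 hδ.le
    linarith
  push_cast at h1 h2
  linarith

lemma tendsto_measure_lt_of_law_of_large_numbers {S : ℕ → Ω → ℕ} {a : ℝ} (ha : 0 ≤ a)
    (h : ∀ κ : ℝ, 0 < κ →
      Tendsto (fun n : ℕ => ν {x | κ * n ≤ |(S n x : ℝ) - n * a|}) atTop (𝓝 0)) :
    Tendsto (fun n : ℕ => ν {x | 2 * (a + 1) * n < (S (n + 1) x : ℝ)}) atTop (𝓝 0) := by
  refine tendsto_of_tendsto_of_tendsto_of_le_of_le' tendsto_const_nhds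
    ((h 1 one_pos).comp (tendsto_add_atTop_nat 1)) (.of_forall fun _ => zero_le) ?_
  filter_upwards [eventually_ge_atTop 1] with n hn
  refine measure_mono fun x hx => ?_
  have hx' : 2 * (a + 1) * n < (S (n + 1) x : ℝ) := hx
  have hn' : (1 : ℝ) ≤ n := by exact_mod_cast hn
  have : 0 ≤ (a + 1) * ((n : ℝ) - 1) := by exact mul_nonneg (by linarith) (by linarith)
  change 1 * ((n + 1 : ℕ) : ℝ) ≤ |(S (n + 1) x : ℝ) - (n + 1 : ℕ) * a|
  refine le_trans ?_ (le_abs_self _)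
  push_cast
  linarith

end

/-! ### Expectations of the largest peak -/

section

variable {Λ Ω : Type*} [MeasurableSpace Λ] [MeasurableSpace Ω] {μ : Measure Λ}
  [IsProbabilityMeasure μ] {P : Measure Ω} [IsProbabilityMeasure P] {σ K : ℝ}

lemma abs_maxPeak_le_one {L : ℝ} (hL : 0 ≤ L) (hK : 0 ≤ K) (g : ℝ≥0 → ℝ) :
    |maxPeak σ L K g| ≤ 1 :=
  abs_le.2 ⟨by linarith [maxPeak_nonneg (σ := σ) (g := g) hL hK], maxPeak_le_one hL⟩

lemma tendsto_integral_maxPeak {L : ℝ} (hσ : |σ| ≤ 1) (hL : 0 ≤ L) (hK : 0 ≤ K)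
    {Y : ℕ → Λ → SkorokhodD} {Z : Ω → SkorokhodD}
    (h : TendstoInDistribution Y atTop Z (fun _ => μ) P) :
    Tendsto (fun n => ∫ x, maxPeak σ L K (Y n x) ∂μ) atTop
      (𝓝 (∫ ω, maxPeak σ L K (Z ω) ∂P)) := by
  have hF := SkorokhodD.continuous_maxPeak hσ hL hK
  have hlim := ProbabilityMeasure.tendsto_iff_forall_integral_tendsto.1 h.tendsto
    (BoundedContinuousFunction.ofNormedAddCommGroup (fun g : SkorokhodD => maxPeak σ L K g) hF 1
      fun g => abs_maxPeak_le_one hL hK g)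
  have hmeas : ∀ ρ : Measure SkorokhodD,
      AEStronglyMeasurable (fun g : SkorokhodD => maxPeak σ L K g) ρ :=
    fun ρ => hF.measurable.aestronglyMeasurable
  simp only [ProbabilityMeasure.coe_mk, BoundedContinuousFunction.coe_ofNormedAddCommGroup] at hlim
  rw [integral_map h.aemeasurable_limit (hmeas _)] at hlim
  exact hlim.congr fun n => integral_map (h.forall_aemeasurable n) (hmeas _)

lemma tendsto_integral_maxPeak_penalty (hσ : |σ| ≤ 1) (hK : 0 ≤ K) {Z : Ω → SkorokhodD}
    (hZ : AEMeasurable Z P) :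
    Tendsto (fun m : ℕ => ∫ ω, maxPeak σ m K (Z ω) ∂P) atTop (𝓝 0) := by
  have := tendsto_integral_of_dominated_convergence (μ := P)
    (F := fun (m : ℕ) ω => maxPeak σ m K (Z ω)) (f := fun _ => 0) (fun _ => 1)
    (fun m => ((SkorokhodD.continuous_maxPeak hσ (Nat.cast_nonneg m)
      hK).measurable.comp_aemeasurable hZ).aestronglyMeasurable)
    (integrable_const 1)
    (fun m => .of_forall fun ω => abs_maxPeak_le_one (Nat.cast_nonneg m) hK _)
    (.of_forall fun ω => tendsto_maxPeak_atTop hσ hK (Z ω).2)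
  simpa using this

lemma measure_le_maxPeak {L c : ℝ} (hσ : |σ| ≤ 1) (hL : 0 ≤ L) (hK : 0 ≤ K) (hc : 0 < c)
    {Y : Λ → SkorokhodD} (hY : AEMeasurable Y μ) :
    μ {x | c ≤ maxPeak σ L K (Y x)} ≤ ENNReal.ofReal (c⁻¹ * ∫ x, maxPeak σ L K (Y x) ∂μ) := by
  have hint : Integrable (fun x => maxPeak σ L K (Y x)) μ :=
    .of_bound ((SkorokhodD.continuous_maxPeak hσ hL
      hK).measurable.comp_aemeasurable hY).aestronglyMeasurable 1
      (.of_forall fun x => abs_maxPeak_le_one hL hK _)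
  have := mul_meas_ge_le_integral_of_nonneg (.of_forall fun x => maxPeak_nonneg hL hK) hint c
  rw [← ofReal_measureReal]
  refine ENNReal.ofReal_le_ofReal ?_
  rwa [← div_eq_inv_mul, le_div_iff₀ hc, mul_comm]

end

/-- If the partial sum processes of `v` converge in law to some random element of `D[0,∞)` with the
`M₁` topology, and the return times to `X` obey a limit theorem with normalization `n ^ (1 / α)`,
`α > 1`, then the maximum of `M₁` over the first `n + 1` excursions is `o(n ^ (1 / α))` in
probability. -/
theorem tendstoInMeasure_max_excursionM1 {Λ Ω : Type*} [MeasurableSpace Λ] [MeasurableSpace Ω]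
    {μ : Measure Λ} [IsProbabilityMeasure μ] {P : Measure Ω} [IsProbabilityMeasure P]
    {T : Λ → Λ} {X : Set Λ} (hX0 : μ X ≠ 0) {α : ℝ} (hα : 1 < α)
    {G : Measure ℝ} [IsProbabilityMeasure G] [IsProbabilityMeasure (ProbabilityTheory.cond μ X)]
    (hreturn : TendstoInDistribution
      (fun (n : ℕ) (x : Λ) => (n : ℝ) ^ (-(1 / α)) *
        (∑ j ∈ Finset.range n, (firstReturnTime T X ((firstReturnMap T X)^[j] x) : ℝ)
          - n * ∫ y, (firstReturnTime T X y : ℝ) ∂(ProbabilityTheory.cond μ X)))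
      atTop (id : ℝ → ℝ) (fun _ => ProbabilityTheory.cond μ X) G)
    {v : Λ → ℝ} {Z : Ω → SkorokhodD}
    (hconv : TendstoInDistribution (fun n : ℕ => partialSumProcess α T v n) atTop Z
      (fun _ => μ) P) :
    TendstoInMeasure (ProbabilityTheory.cond μ X)
      (fun (n : ℕ) (x : Λ) => (n : ℝ) ^ (-(1 / α)) *
        (Finset.range (n + 1)).sup' Finset.nonempty_range_add_one
          (fun j => excursionM1 T X v ((firstReturnMap T X)^[j] x)))
      atTop (fun _ => 0) := by
  set ν := ProbabilityTheory.cond μ X with hν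
  set S : ℕ → Λ → ℕ := birkhoffSum (firstReturnMap T X) (firstReturnTime T X) with hS
  set a := ∫ y, (firstReturnTime T X y : ℝ) ∂ν
  have ha : 0 ≤ a := integral_nonneg fun y => Nat.cast_nonneg _
  set K := 2 * (a + 1)
  have hK : 0 ≤ K := by positivity
  have hlln : ∀ κ : ℝ, 0 < κ →
      Tendsto (fun n : ℕ => ν {x | κ * n ≤ |(S n x : ℝ) - n * a|}) atTop (𝓝 0) := fun κ hκ => by
    simpa only [hS, birkhoffSum, Nat.cast_sum] using
      tendsto_measure_le_abs_sub (ν := ν) hα (a := a) hreturn hκ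
  have hSmono : ∀ x, Monotone fun m => S m x := fun x =>
    monotone_nat_of_le_succ fun m => by simp only [hS, birkhoffSum_succ]; omega
  have hνμ : ∀ s, ν s ≤ (μ X)⁻¹ * μ s := fun s => by
    rw [hν, ProbabilityTheory.cond, Measure.smul_apply, smul_eq_mul]
    exact mul_le_mul_right (Measure.restrict_apply_le X s) _
  have hXinv : (μ X)⁻¹ ≠ ∞ := ENNReal.inv_ne_top.2 hX0
  refine tendstoInMeasure_of_ne_top fun ε hε hεtop => ENNReal.tendsto_nhds_zero.2 fun e he => ?_
  have hεr : 0 < ε.toReal := ENNReal.toReal_pos hε.ne' hεtop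
  set η := ε.toReal / 4
  have hη : 0 < η := by positivity
  set c := min η 1 / 2
  have hc : 0 < c := half_pos (lt_min hη one_pos)
  -- Markov's inequality bounds the probability of a large peak or valley by `R m n`.
  set R : ℕ → ℕ → ℝ≥0∞ := fun m n =>
    (μ X)⁻¹ * (ENNReal.ofReal (c⁻¹ * ∫ x, maxPeak 1 m K (partialSumProcess α T v n x) ∂μ) +
      ENNReal.ofReal (c⁻¹ * ∫ x, maxPeak (-1) m K (partialSumProcess α T v n x) ∂μ)) with hR
  set Q : ℕ → ℝ≥0∞ := fun m =>
    (μ X)⁻¹ * (ENNReal.ofReal (c⁻¹ * ∫ ω, maxPeak 1 m K (Z ω) ∂P) +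
      ENNReal.ofReal (c⁻¹ * ∫ ω, maxPeak (-1) m K (Z ω) ∂P))
  have h1 : |(1 : ℝ)| ≤ 1 := by simp
  have h2 : |(-1 : ℝ)| ≤ 1 := by simp
  have hQ : Tendsto Q atTop (𝓝 0) := by
    have h3 := fun {σ : ℝ} (hσ : |σ| ≤ 1) => ENNReal.tendsto_ofReal
      ((tendsto_integral_maxPeak_penalty hσ hK hconv.aemeasurable_limit).const_mul c⁻¹)
    simpa [Q] using ENNReal.Tendsto.const_mul ((h3 h1).add (h3 h2)) (.inr hXinv)
  have hRQ : ∀ m, Tendsto (R m) atTop (𝓝 (Q m)) := fun m => by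
    have h3 := fun {σ : ℝ} (hσ : |σ| ≤ 1) => ENNReal.tendsto_ofReal
      ((tendsto_integral_maxPeak hσ (Nat.cast_nonneg m) hK hconv).const_mul c⁻¹)
    exact ENNReal.Tendsto.const_mul ((h3 h1).add (h3 h2)) (.inr hXinv)
  obtain ⟨m, hme, hm⟩ := ((hQ.eventually_lt_const he).and (eventually_gt_atTop 0)).exists
  have hm0 : (0 : ℝ) < m := by exact_mod_cast hm
  -- The duration of an excursion is penalized by at most `m δ = c`.
  set δ := c / m with hδ
  have hδ0 : 0 < δ := div_pos hc hm0
  have hlim := ((tendsto_measure_exists_lt_increment (fun x => birkhoffSum_zero ..) hSmono ha hlln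
    hδ0).add (tendsto_measure_lt_of_law_of_large_numbers ha hlln)).add (hRQ m)
  rw [add_zero, zero_add] at hlim
  filter_upwards [hlim.eventually_lt_const hme, eventually_ne_atTop 0] with n hn hn0
  refine le_trans ?_ hn.le
  have hmark : ∀ {σ : ℝ}, |σ| ≤ 1 → _ := fun {σ} hσ =>
    measure_le_maxPeak hσ (Nat.cast_nonneg m) hK hc (hconv.forall_aemeasurable n)
  refine le_trans ?_ (add_le_add_right ((hνμ _).trans (mul_le_mul_right
    ((measure_union_le _ _).trans (add_le_add (hmark h1) (hmark h2))) _)) _)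
  refine le_trans (measure_mono fun x hx => ?_)
    ((measure_union_le _ _).trans (add_le_add_left (measure_union_le _ _) _))
  by_contra hcon
  simp only [mem_union, mem_ofPred_eq, not_or, not_exists, not_and, not_lt, not_le] at hcon
  obtain ⟨⟨hinc, htot⟩, hpeak, hvalley⟩ := hcon
  have hn0' : (0 : ℝ) < n := by positivity
  have hpow : 0 < (n : ℝ) ^ (-(1 / α)) := Real.rpow_pos_of_pos hn0' _
  obtain ⟨j, hj, hjmax⟩ := Finset.exists_mem_eq_sup' (Finset.nonempty_range_add_one (n := n))
    (fun j => excursionM1 T X v ((firstReturnMap T X)^[j] x))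
  have hjn : j ≤ n := by
    rw [Finset.mem_range] at hj
    omega
  have hx' : ε.toReal ≤ (n : ℝ) ^ (-(1 / α)) *
      excursionM1 T X v ((firstReturnMap T X)^[j] x) := by
    have hx' : ε ≤ edist _ _ := hx
    rw [hjmax, edist_dist, Real.dist_eq, sub_zero,
      abs_of_nonneg (mul_nonneg hpow.le (excursionM1_nonneg _))] at hx'
    exact ENNReal.toReal_le_of_le_ofReal (mul_nonneg hpow.le (excursionM1_nonneg _)) hx'
  obtain ⟨σ, hσ, hle⟩ := exists_le_maxPeak_of_lt_excursionM1 (δ := δ) (K := K) hn0 hη.le hm0.le hjn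
    (lt_of_lt_of_le (by simp only [η]; linarith) hx')
    (by
      have := hinc j hjn
      simp only [birkhoffSum_succ] at this
      push_cast at this
      linarith)
    htot
  have hmδ : m * δ = c := mul_div_cancel₀ _ hm0.ne'
  have hcc : min η 1 = c + c := (add_halves _).symm
  rcases hσ with rfl | rfl
  · linarith
  · linarith

end LevyWIP

theorem mainTheorem7
    {Λ : Type*} [MetricSpace Λ] [MeasurableSpace Λ] [BorelSpace Λ]
    (μ : Measure Λ) [IsProbabilityMeasure μ]
    (T : Λ → Λ) (hT : Ergodic T μ)
    (X : Set Λ) (hX : MeasurableSet X) (hX0 : μ X ≠ 0)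
    (α : ℝ) (hα : α ∈ Set.Ioo (1 : ℝ) 2)
    (G : Measure ℝ) [IsProbabilityMeasure G] (hG : LevyWIP.IsStableLaw α G)
    (hstable :
      haveI : IsProbabilityMeasure (cond μ X) := cond_isProbabilityMeasure hX0
      TendstoInDistribution
        (fun (n : ℕ) (x : Λ) => (n : ℝ) ^ (-(1 / α)) *
          (∑ j ∈ Finset.range n,
              (LevyWIP.firstReturnTime T X ((LevyWIP.firstReturnMap T X)^[j] x) : ℝ)
            - n * ∫ y, (LevyWIP.firstReturnTime T X y : ℝ) ∂(cond μ X)))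
        atTop (id : ℝ → ℝ) (fun _ => cond μ X) G)
    (v : Λ → ℝ) (hv : ∃ C η : ℝ≥0, 0 < η ∧ HolderWith C η v)
    (hv_int : Integrable v μ) (hv_mean : ∫ x, v x ∂μ = 0)
    {Ω : Type*} [MeasurableSpace Ω] (P : Measure Ω) [IsProbabilityMeasure P]
    (W : Ω → LevyWIP.SkorokhodD) (hW : LevyWIP.IsLevyProcess P W)
    (hWG : P.map (fun ω => W ω 1) = G)
    (I : ℝ) (hI : I ≠ 0)
    (hconv : TendstoInDistribution (fun n : ℕ => LevyWIP.partialSumProcess α T v n)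
      atTop (fun ω => I • W ω) (fun _ => μ) P) :
    TendstoInMeasure (cond μ X)
      (fun (n : ℕ) (x : Λ) => (n : ℝ) ^ (-(1 / α)) *
        (Finset.range (n + 1)).sup' Finset.nonempty_range_add_one
          (fun j => LevyWIP.excursionM1 T X v ((LevyWIP.firstReturnMap T X)^[j] x)))
      atTop (fun _ => 0) := by
  have : IsProbabilityMeasure (cond μ X) := cond_isProbabilityMeasure hX0
  exact LevyWIP.tendstoInMeasure_max_excursionM1 hX0 hα.1 hstable hconv
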